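/- Let $\Delta=\{z\in\mathbb{C}:|z|<1\}$. For functions $f,g$ analytic in $\Delta$, write $f\prec g$ ($f$ is subordinate to $g$ in $\Delta$) if there is an analytic function $w$ on $\Delta$ with $w(0)=0$ and $|w(z)|<1$ for all $z\in\Delta$ such that $f(z)=g(w(z))$ for all $z\in\Delta$. For $0\le\alpha<1$ let $\mathcal{BS}(\alpha)$ be the class of all functions $f$ analytic in $\Delta$ with $f(0)=0$, $f'(0)=1$ and $$\frac{zf'(z)}{f(z)}-1\;\prec\;\frac{z}{1-\alpha z^2}\qquad(z\in\Delta),$$ where the left-hand side takes the value $0$ at $z=0$ (removable singularity). **Theorem.** Let $0\le\alpha\le 3-2\sqrt2$ and $f\in\mathcal{BS}(\alpha)$. Then $$\frac{f(z)}{z}\;\prec\;F(z)\qquad(z\in\Delta),$$ where $f(z)/z$ takes the value $1$ at $z=0$ and $$F(z)=\left(\frac{1+\sqrt{\alpha}\,z}{1-\sqrt{\alpha}\,z}\right)^{1/(2\sqrt{\alpha})}\quad(0<\alpha\le 3-2\sqrt2),\qquad F(z)=e^{z}\quad(\alpha=0),$$ the power being taken with the principal branch. -/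

import Mathlib

noncomputable section

namespace BoothStarlike

/-- The open unit disk `Δ` of the complex plane. -/
def unitDisk : Set ℂ := Metric.ball 0 1

/-- The class of analytic functions `f` on the unit disk with `f 0 = 0` and `f' 0 = 1`. -/
def NormalizedAnalytic (f : ℂ → ℂ) : Prop :=
  AnalyticOnNhd ℂ f unitDisk ∧ f 0 = 0 ∧ deriv f 0 = 1

/-- Schwarz functions: `w` analytic on the unit disk, `w 0 = 0`, and `|w z| < 1` there. -/
def IsSchwarzFunction (w : ℂ → ℂ) : Prop :=
  AnalyticOnNhd ℂ w unitDisk ∧ w 0 = 0 ∧ ∀ z ∈ unitDisk, ‖w z‖ < 1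

/-- Subordination `f ≺ g` in the unit disk: `f = g ∘ w` on the disk for a Schwarz function `w`. -/
def Subordinate (f g : ℂ → ℂ) : Prop :=
  ∃ w : ℂ → ℂ, IsSchwarzFunction w ∧ ∀ z ∈ unitDisk, f z = g (w z)

/-- The function `F_α(z) = z / (1 - α z²)`. -/
def boothMap (α : ℝ) (z : ℂ) : ℂ := z / (1 - (α : ℂ) * z ^ 2)

/-- The function `z f'(z) / f(z) - 1`, with the value `0` at the origin, which is the value of
its analytic continuation there when `f 0 = 0` and `f' 0 = 1`. -/
def starlikeQuotient (f : ℂ → ℂ) : ℂ → ℂ :=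
  Function.update (fun z => z * deriv f z / f z - 1) 0 0

/-- The class `BS(α)`, `0 ≤ α < 1`: normalized analytic functions `f` on the unit disk with
`z f'(z) / f(z) - 1 ≺ z / (1 - α z²)`. No zero of `f` other than the origin is possible here:
`z f'(z) / f(z)` is unbounded near such a zero, while `F_α ∘ w` is continuous. -/
def BS (α : ℝ) : Set (ℂ → ℂ) :=
  {f | NormalizedAnalytic f ∧ Subordinate (starlikeQuotient f) (boothMap α)}

/-- The function `f(z) / z`, with the value `1` at the origin, which is the value of its analytic
continuation there when `f 0 = 0` and `f' 0 = 1`. -/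
def divZ (f : ℂ → ℂ) : ℂ → ℂ :=
  Function.update (fun z => f z / z) 0 1

/-- The function `F(z) = ((1 + √α z) / (1 - √α z)) ^ (1 / (2√α))` (principal branch; on the unit
disk the base lies in the right half-plane for `0 < α ≤ 1`), read for `α = 0` as its limit
`exp z`. -/
def extremalQuotient (α : ℝ) (z : ℂ) : ℂ :=
  if α = 0 then Complex.exp z
  else ((1 + (Real.sqrt α : ℂ) * z) / (1 - (Real.sqrt α : ℂ) * z)) ^
    ((1 / (2 * Real.sqrt α) : ℝ) : ℂ)

end BoothStarlike

end

open Metric Set Filter Topology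

namespace BoothStarlike

/-! Let `w` be the given Schwarz function and `F_α` the map `boothMap α`. Integrating `F_α(w(z))/z`
from the origin gives `Q` with `f(z)/z = exp Q`. Solving `exp Q = F(v)` gives `v = tanh(√α Q)/√α`
(`v = Q` if `α = 0`), and then `z v' = (1 - α v²) F_α(w)`. It remains to see that `|v| < 1`. At a
point `z₀` of least modulus with `|v(z₀)| ≥ 1`, Jack's lemma gives `z₀ v'(z₀) = k v(z₀)` with `k ≥
1`, so `k F_α(v(z₀)) = F_α(w(z₀))`, which starlikeness of `F_α` forbids. The bound on `α` enters
through `|2√α Q| ≤ 1`: it keeps `v` free of poles and makes the principal logarithm invert the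
exponential. -/

lemma isOpen_unitDisk : IsOpen unitDisk := isOpen_ball

lemma mem_unitDisk {z : ℂ} : z ∈ unitDisk ↔ ‖z‖ < 1 := mem_ball_zero_iff

lemma zero_mem_unitDisk : (0 : ℂ) ∈ unitDisk := by simp [mem_unitDisk]

lemma unitDisk_mem_nhds_zero : unitDisk ∈ 𝓝 (0 : ℂ) :=
  isOpen_unitDisk.mem_nhds zero_mem_unitDisk

lemma isPreconnected_unitDisk : IsPreconnected unitDisk := (convex_ball (0 : ℂ) 1).isPreconnected

lemma analyticOnNhd_unitDisk_iff {f : ℂ → ℂ} :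
    AnalyticOnNhd ℂ f unitDisk ↔ DifferentiableOn ℂ f unitDisk :=
  Complex.analyticOnNhd_iff_differentiableOn isOpen_unitDisk

/-! ### Jack's lemma -/

/-- If `u` has modulus at most one on the left half-plane and `u 0 = 1`, then `u' 0` is real and
nonnegative. -/
lemma deriv_nonneg_of_norm_le_one {u : ℂ → ℂ} {u' : ℂ} (hu : HasDerivAt u u' 0) (h0 : u 0 = 1)
    (hle : ∀ x : ℂ, x.re < 0 → ‖u x‖ ≤ 1) : u'.im = 0 ∧ 0 ≤ u'.re := by
  have key : ∀ d : ℂ, d.re < 0 → (u' * d).re ≤ 0 := by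
    intro d hd
    have h1 : HasDerivAt (fun t : ℝ => (u ((t : ℂ) * d)).re) (u' * d).re 0 := by
      have h2 : HasDerivAt (fun t : ℂ => t * d) d (0 : ℝ) := by
        simpa using (hasDerivAt_id (((0 : ℝ) : ℂ))).mul_const d
      have h3 : HasDerivAt u u' (((0 : ℝ) : ℂ) * d) := by simpa using hu
      exact (HasDerivAt.comp (h₂ := u) (h := fun t : ℂ => t * d) _ h3 h2).real_of_complex
    by_contra! hpos
    have h4 := (hasDerivAt_iff_tendsto_slope_zero.1 h1).mono_left
      (nhdsWithin_mono 0 (fun x hx => ne_of_gt hx) : 𝓝[>] (0 : ℝ) ≤ 𝓝[≠] 0)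
    have h5 : (u' * d).re ≤ 0 := by
      refine le_of_tendsto h4 ?_
      filter_upwards [self_mem_nhdsWithin] with t ht
      have ht : 0 < t := ht
      have h6 : (u ((t : ℂ) * d)).re ≤ 1 :=
        (Complex.re_le_norm _).trans (hle _ (by simpa using mul_neg_of_pos_of_neg ht hd))
      have h7 : (u ((t : ℂ) * d)).re - 1 ≤ 0 := by linarith
      simpa [h0] using mul_nonpos_of_nonneg_of_nonpos (inv_nonneg.2 ht.le) h7
    linarith
  -- The direction `-1 + iN` points into the half-plane for every real `N`, so a nonzero imaginary
  -- part of `u'` would violate the inequality for a suitable `N`.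
  have key' : ∀ N : ℝ, -u'.re - u'.im * N ≤ 0 := by
    intro N
    have := key (⟨-1, N⟩ : ℂ) (by simp)
    simpa [Complex.mul_re] using this
  have him : u'.im = 0 := by
    by_contra hne
    have := key' (-(u'.re + 1) / u'.im)
    field_simp at this
    linarith
  refine ⟨him, ?_⟩
  have := key' 0
  linarith

/-- **Jack's lemma**: if `v` vanishes at the origin and `‖v‖` is less than one on the disk of
radius `‖z₀‖`, with `‖v z₀‖ = 1`, then `z₀ v'(z₀) = k v(z₀)` for some real `k ≥ 1`. -/
lemma jack {v : ℂ → ℂ} {z₀ v' : ℂ} (hv : DifferentiableOn ℂ v (ball 0 ‖z₀‖)) (h0 : v 0 = 0)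
    (hlt : ∀ z ∈ ball (0 : ℂ) ‖z₀‖, ‖v z‖ ≤ 1) (h1 : ‖v z₀‖ = 1) (hd : HasDerivAt v v' z₀) :
    ∃ k : ℝ, 1 ≤ k ∧ z₀ * v' = k * v z₀ := by
  have hv0 : v z₀ ≠ 0 := by
    intro h
    simp [h] at h1
  have hz0 : 0 < ‖z₀‖ := by
    rw [norm_pos_iff]
    rintro rfl
    exact hv0 h0
  -- In the coordinate `z = z₀ eˣ` the disk becomes the left half-plane. The Schwarz lemma says
  -- `|v(z)| ≤ |z|/|z₀| = |eˣ|`, that is `|u| ≤ 1`, and `u'(0) = z₀ v'/v(z₀) - 1`.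
  let u : ℂ → ℂ := fun x => v (z₀ * Complex.exp x) / v z₀ * Complex.exp (-x)
  have hu : HasDerivAt u (z₀ * v' / v z₀ - 1) 0 := by
    have a1 : HasDerivAt (fun x => z₀ * Complex.exp x) z₀ 0 := by
      simpa using (Complex.hasDerivAt_exp 0).const_mul z₀
    have a2 : HasDerivAt v v' (z₀ * Complex.exp 0) := by simpa using hd
    have a3 : HasDerivAt (fun x : ℂ => Complex.exp (-x)) (-1) 0 := by
      simpa using (hasDerivAt_neg (0 : ℂ)).cexp
    have a4 := ((a2.comp (0 : ℂ) a1).div_const (v z₀)).mul a3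
    refine a4.congr_deriv ?_
    simp [hv0]
    ring
  have hu0 : u 0 = 1 := by simp [u, hv0]
  obtain ⟨him, hre⟩ := deriv_nonneg_of_norm_le_one hu hu0 (by
    intro x hx
    have hexp : ‖Complex.exp x‖ < 1 := by
      rw [Complex.norm_exp]
      simpa using hx
    have hmem : z₀ * Complex.exp x ∈ ball (0 : ℂ) ‖z₀‖ := by
      rw [mem_ball_zero_iff, norm_mul]
      nlinarith
    have hS := Complex.dist_le_div_mul_dist_of_mapsTo_ball (R₂ := 1) hv
      (fun z hz => by simpa [h0] using hlt z hz) hmem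
    rw [h0, dist_zero_right, dist_zero_right, norm_mul, one_div, inv_mul_cancel_left₀ hz0.ne'] at hS
    rw [norm_mul, norm_div, h1, div_one, Complex.exp_neg, norm_inv]
    exact mul_inv_le_one_of_le₀ hS (norm_nonneg _))
  refine ⟨(z₀ * v' / v z₀).re, by simpa using hre, ?_⟩
  have hreal : (((z₀ * v' / v z₀).re : ℝ) : ℂ) = z₀ * v' / v z₀ := by
    apply Complex.ext
    · simp
    · simpa using him.symm
  rw [hreal, div_mul_cancel₀ _ hv0]

/-! ### Starlikeness of the Booth map and the bound on `v` -/

lemma norm_real_mul_sq_lt_one {α : ℝ} (hα₀ : 0 ≤ α) (hα₁ : α < 1) {ζ : ℂ} (hζ : ‖ζ‖ ≤ 1) :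
    ‖(α : ℂ) * ζ ^ 2‖ < 1 := by
  rw [norm_mul, norm_pow, Complex.norm_real, Real.norm_of_nonneg hα₀]
  have : ‖ζ‖ ^ 2 ≤ 1 := pow_le_one₀ (norm_nonneg _) hζ
  nlinarith

lemma one_sub_real_mul_sq_ne_zero {α : ℝ} (hα₀ : 0 ≤ α) (hα₁ : α < 1) {ζ : ℂ} (hζ : ‖ζ‖ ≤ 1) :
    1 - (α : ℂ) * ζ ^ 2 ≠ 0 := by
  intro h
  have := norm_real_mul_sq_lt_one hα₀ hα₁ hζ
  rw [← sub_eq_zero.1 h] at this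
  simp at this

/-- The map `z / (1 - α z²)` is starlike: no point of the boundary of the image of the disk, moved
away from the origin, lies in the image. -/
lemma boothMap_starlike {α : ℝ} (hα₀ : 0 ≤ α) (hα₁ : α < 1) {ζ w : ℂ} (hζ : ‖ζ‖ = 1)
    (hw : ‖w‖ < 1) {k : ℝ} (hk : 1 ≤ k) : (k : ℂ) * boothMap α ζ ≠ boothMap α w := by
  intro h
  have hdζ := one_sub_real_mul_sq_ne_zero hα₀ hα₁ hζ.le
  have hdw := one_sub_real_mul_sq_ne_zero hα₀ hα₁ hw.le
  have hζ0 : ζ ≠ 0 := by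
    rintro rfl
    simp at hζ
  have hkc : (k : ℂ) ≠ 0 := by
    exact_mod_cast (by linarith : k ≠ 0)
  unfold boothMap at h
  have hw0 : w ≠ 0 := by
    rintro rfl
    simp [hkc, hζ0, hdζ] at h
  set a := ζ.re
  set b := ζ.im
  set c := w.re
  set d := w.im
  have hab : a ^ 2 + b ^ 2 = 1 := by
    have := Complex.sq_norm ζ
    rw [hζ, Complex.normSq_apply] at this
    nlinarith
  set R := c ^ 2 + d ^ 2 with hR
  have hRn : R = ‖w‖ ^ 2 := by
    rw [Complex.sq_norm, Complex.normSq_apply]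
    ring
  have hRpos : 0 < R := by
    rw [hRn]
    positivity
  have hRlt : R < 1 := by
    rw [hRn]
    exact pow_lt_one₀ (norm_nonneg _) hw (by norm_num)
  have hζc : ζ * (starRingEnd ℂ) ζ = 1 := by
    rw [Complex.mul_conj, Complex.normSq_apply]
    norm_cast
    nlinarith
  have hwc : w * (starRingEnd ℂ) w = R := by
    rw [Complex.mul_conj, Complex.normSq_apply, hR]
    congr 1
    ring
  -- Reciprocals of both sides, cleared of denominators: `1/F_α(ζ) = conj ζ - α ζ` on the circle,
  -- and `1/F_α(w) = conj w / R - α w`. Real and imaginary parts then separate.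
  have hinv : (R : ℂ) * ((starRingEnd ℂ) ζ - α * ζ) = k * ((starRingEnd ℂ) w - α * R * w) := by
    rw [mul_div_assoc', div_eq_div_iff hdζ hdw] at h
    have hne : ζ * w ≠ 0 := mul_ne_zero hζ0 hw0
    apply mul_left_cancel₀ hne
    linear_combination (-(R : ℂ)) * h + (R * w) * hζc - (k * ζ) * hwc
  have hre := congrArg Complex.re hinv
  have him := congrArg Complex.im hinv
  have hre' : R * ((1 - α) * a) = k * ((1 - α * R) * c) := by
    simp at hre
    linarith
  have him' : R * ((1 + α) * b) = k * ((1 + α * R) * d) := by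
    simp at him
    linarith
  have hk2 : 1 ≤ k ^ 2 := one_le_pow₀ hk
  have hA : c ^ 2 ≤ R ^ 2 * a ^ 2 := by
    have h1 : (1 - α) ^ 2 * c ^ 2 ≤ (1 - α) ^ 2 * (R ^ 2 * a ^ 2) :=
      calc (1 - α) ^ 2 * c ^ 2 ≤ (1 - α * R) ^ 2 * c ^ 2 := by
            gcongr
            exact mul_le_of_le_one_right hα₀ hRlt.le
        _ ≤ k ^ 2 * ((1 - α * R) ^ 2 * c ^ 2) := le_mul_of_one_le_left (by positivity) hk2
        _ = (k * ((1 - α * R) * c)) ^ 2 := by ring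
        _ = (1 - α) ^ 2 * (R ^ 2 * a ^ 2) := by
            rw [← hre']
            ring
    exact le_of_mul_le_mul_left h1 (pow_pos (by linarith) 2)
  have hB : (1 + α * R) ^ 2 * d ^ 2 ≤ (1 + α) ^ 2 * (R ^ 2 * b ^ 2) :=
    calc (1 + α * R) ^ 2 * d ^ 2 ≤ k ^ 2 * ((1 + α * R) ^ 2 * d ^ 2) :=
          le_mul_of_one_le_left (by positivity) hk2
      _ = (k * ((1 + α * R) * d)) ^ 2 := by ring
      _ = (1 + α) ^ 2 * (R ^ 2 * b ^ 2) := by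
          rw [← him']
          ring
  rcases eq_or_ne d 0 with hd | hd
  · have hcR : c ^ 2 = R := by rw [hR, hd]; ring
    nlinarith [sq_nonneg b, mul_nonneg (sq_nonneg R) (sq_nonneg b)]
  -- The difference of the two sides is `(1 - R)(1 - α² R)`. Together with `hA` and `hB` this yields
  -- `R (c² + d²) < R² (a² + b²)`, where both sides equal `R²`.
  · have h1 : R * (1 + α) ^ 2 < (1 + α * R) ^ 2 := by
      have : 0 < (1 - R) * (1 - α ^ 2 * R) := by
        have h2 : α ^ 2 < 1 := pow_lt_one₀ hα₀ hα₁ (by norm_num)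
        exact mul_pos (by linarith) (by nlinarith)
      linarith
    have hd2 : 0 < d ^ 2 := by positivity
    have h2 : (1 + α) ^ 2 * (R * d ^ 2) < (1 + α) ^ 2 * (R ^ 2 * b ^ 2) := by
      linarith [mul_lt_mul_of_pos_right h1 hd2]
    have h3 := lt_of_mul_lt_mul_left h2 (by positivity)
    have h4 : R * c ^ 2 ≤ c ^ 2 := mul_le_of_le_one_left (sq_nonneg c) hRlt.le
    have h5 : R ^ 2 * (a ^ 2 + b ^ 2) = R * (c ^ 2 + d ^ 2) := by rw [hab, ← hR]; ring
    linarith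

/-- If `v 0 = 0` and `z v' = (1 - α v²) F_α(w)` for a Schwarz function `w`, then `v` is a Schwarz
function. -/
lemma norm_lt_one_of_mul_deriv_eq {α : ℝ} (hα₀ : 0 ≤ α) (hα₁ : α < 1) {v v' w : ℂ → ℂ}
    (hv : ∀ z ∈ unitDisk, HasDerivAt v (v' z) z) (h0 : v 0 = 0)
    (hw : ∀ z ∈ unitDisk, ‖w z‖ < 1)
    (hode : ∀ z ∈ unitDisk, z * v' z = (1 - α * v z ^ 2) * boothMap α (w z)) :
    ∀ z ∈ unitDisk, ‖v z‖ < 1 := by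
  intro z₁ hz₁
  by_contra! hge
  have hz₁' := mem_unitDisk.1 hz₁
  have hsub : closedBall (0 : ℂ) ‖z₁‖ ⊆ unitDisk := closedBall_subset_ball hz₁'
  have hcont : ContinuousOn v (closedBall 0 ‖z₁‖) := fun z hz =>
    (hv z (hsub hz)).continuousAt.continuousWithinAt
  have hclosed : IsClosed (closedBall (0 : ℂ) ‖z₁‖ ∩ (fun z => ‖v z‖) ⁻¹' Ici 1) :=
    hcont.norm.preimage_isClosed_of_isClosed isClosed_closedBall isClosed_Ici
  have hcomp := (isCompact_closedBall (0 : ℂ) ‖z₁‖).of_isClosed_subset hclosed inter_subset_left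
  obtain ⟨z₀, ⟨hz₀, hz₀v⟩, hmin⟩ :=
    hcomp.exists_isMinOn ⟨z₁, by simp, hge⟩ (continuous_norm.continuousOn)
  have hlt : ∀ z ∈ ball (0 : ℂ) ‖z₀‖, ‖v z‖ < 1 := by
    intro z hz
    by_contra! hz'
    have hz := mem_ball_zero_iff.1 hz
    have hz₀ := mem_closedBall_zero_iff.1 hz₀
    have := hmin (show z ∈ _ from ⟨mem_closedBall_zero_iff.2 (hz.le.trans hz₀), hz'⟩)
    exact absurd hz (not_lt.2 this)
  have hz₀d := hsub hz₀
  have hz₀v : 1 ≤ ‖v z₀‖ := hz₀v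
  have hz₀0 : z₀ ≠ 0 := by
    rintro rfl
    simp [h0] at hz₀v
    linarith
  have hone : ‖v z₀‖ = 1 := by
    refine le_antisymm ?_ hz₀v
    have hmem : z₀ ∈ closure (ball (0 : ℂ) ‖z₀‖) := by
      rw [closure_ball _ (norm_ne_zero_iff.2 hz₀0)]
      simp
    exact le_of_tendsto_of_frequently (hv z₀ hz₀d).continuousAt.norm
      ((mem_closure_iff_frequently.1 hmem).mono fun z hz => (hlt z hz).le)
  have hsub₀ : ball (0 : ℂ) ‖z₀‖ ⊆ unitDisk := ball_subset_ball (mem_unitDisk.1 hz₀d).le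
  obtain ⟨k, hk, hkv⟩ := jack (fun z hz => (hv z (hsub₀ hz)).differentiableAt.differentiableWithinAt)
    h0 (fun z hz => (hlt z hz).le) hone (hv z₀ hz₀d)
  refine boothMap_starlike hα₀ hα₁ hone (hw z₀ hz₀d) hk ?_
  have hne := one_sub_real_mul_sq_ne_zero hα₀ hα₁ hone.le
  have h2 := hode z₀ hz₀d
  rw [hkv] at h2
  apply mul_left_cancel₀ hne
  rw [← h2]
  unfold boothMap
  field_simp

lemma differentiableOn_boothMap_comp {α : ℝ} (hα₀ : 0 ≤ α) (hα₁ : α < 1) {w : ℂ → ℂ}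
    (hw : IsSchwarzFunction w) : DifferentiableOn ℂ (fun z => boothMap α (w z)) unitDisk := by
  have hd := analyticOnNhd_unitDisk_iff.1 hw.1
  unfold boothMap
  exact hd.div ((hd.pow 2).const_mul _ |>.const_sub _)
    fun z hz => one_sub_real_mul_sq_ne_zero hα₀ hα₁ (hw.2.2 z hz).le

lemma norm_boothMap_le {α : ℝ} (hα₀ : 0 ≤ α) (hα₁ : α < 1) {ζ : ℂ} (hζ : ‖ζ‖ ≤ 1) :
    ‖boothMap α ζ‖ ≤ 1 / (1 - α) := by
  unfold boothMap
  rw [norm_div]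
  have h1 : 1 - α ≤ ‖1 - (α : ℂ) * ζ ^ 2‖ := by
    have h2 := norm_sub_norm_le (1 : ℂ) ((α : ℂ) * ζ ^ 2)
    rw [norm_one, norm_mul, norm_pow, Complex.norm_real, Real.norm_of_nonneg hα₀] at h2
    have : ‖ζ‖ ^ 2 ≤ 1 := pow_le_one₀ (norm_nonneg _) hζ
    nlinarith
  exact div_le_div₀ zero_le_one hζ (by linarith) h1

/-! ### The representation `f(z)/z = exp Q` -/

/-- A function `H` on the disk with `H 0 = 0` and `‖H‖ ≤ C` equals `z Q'` for some `Q` with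
`Q 0 = 0`, and `‖Q‖ ≤ C`. -/
lemma exists_mul_deriv_eq {H : ℂ → ℂ} {C : ℝ} (hH : DifferentiableOn ℂ H unitDisk) (h0 : H 0 = 0)
    (hC : ∀ z ∈ unitDisk, ‖H z‖ ≤ C) :
    ∃ Q Q' : ℂ → ℂ, (∀ z ∈ unitDisk, HasDerivAt Q (Q' z) z) ∧ Q 0 = 0 ∧
      (∀ z ∈ unitDisk, z * Q' z = H z) ∧ ∀ z ∈ unitDisk, ‖Q z‖ ≤ C := by
  have hds : DifferentiableOn ℂ (dslope H 0) unitDisk :=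
    (Complex.differentiableOn_dslope unitDisk_mem_nhds_zero).2 hH
  -- `Q` is a primitive of `H(z)/z`, which the Schwarz lemma bounds by `C`.
  obtain ⟨Q, hQ0, hQ⟩ := (DifferentiableOn.isExactOn_ball hds).with_val_at 0 0
  refine ⟨Q, dslope H 0, hQ, hQ0, fun z _ => ?_, fun z hz => ?_⟩
  · simpa [h0] using sub_smul_dslope H 0 z
  · have hC0 : 0 ≤ C := (norm_nonneg _).trans (hC 0 zero_mem_unitDisk)
    have h1 := (convex_ball (0 : ℂ) 1).norm_image_sub_le_of_norm_hasDerivWithin_le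
      (f := Q) (f' := dslope H 0) (C := C) (x := 0) (y := z)
      (fun x hx => (hQ x hx).hasDerivWithinAt) (fun x hx => by
        simpa using Complex.norm_dslope_le_div_of_mapsTo_ball (R₂ := C) hH
          (fun y hy => by simpa [h0] using hC y hy) hx) zero_mem_unitDisk hz
    rw [hQ0, sub_zero, sub_zero] at h1
    exact h1.trans (mul_le_of_le_one_right hC0 (mem_unitDisk.1 hz).le)

lemma divZ_eq_dslope {f : ℂ → ℂ} (hf : NormalizedAnalytic f) : divZ f = dslope f 0 := by
  funext z
  rcases eq_or_ne z 0 with rfl | hz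
  · simp [divZ, hf.2.2]
  · simp [divZ, hz, dslope_of_ne, slope_def_field, hf.2.1]

/-- If `z f' / f - 1 = z Q'` on the disk, then `f z / z = exp (Q z)`. -/
lemma divZ_eq_exp {f Q Q' : ℂ → ℂ} (hf : NormalizedAnalytic f)
    (hQ : ∀ z ∈ unitDisk, HasDerivAt Q (Q' z) z) (hQ0 : Q 0 = 0)
    (hfQ : ∀ z ∈ unitDisk, starlikeQuotient f z = z * Q' z) :
    ∀ z ∈ unitDisk, divZ f z = Complex.exp (Q z) := by
  rw [divZ_eq_dslope hf]
  have hfd := analyticOnNhd_unitDisk_iff.1 hf.1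
  set p := dslope f 0 with hp
  have hpd : DifferentiableOn ℂ p unitDisk :=
    (Complex.differentiableOn_dslope unitDisk_mem_nhds_zero).2 hfd
  have hp0 : p 0 = 1 := by simp [hp, hf.2.2]
  have hfp : ∀ z, f z = z * p z := fun z => by
    simpa [hf.2.1] using (sub_smul_dslope f 0 z).symm
  have hpdiff : ∀ z ∈ unitDisk, DifferentiableAt ℂ p z := fun z hz =>
    (hpd z hz).differentiableAt (isOpen_unitDisk.mem_nhds hz)
  have hQd : DifferentiableOn ℂ Q unitDisk := fun z hz =>
    (hQ z hz).differentiableAt.differentiableWithinAt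
  have hlog : ∀ z ∈ unitDisk, deriv p z = p z * deriv Q z := by
    -- Dividing by `p` is safe only near the origin, where `p` is close to `1`; the identity theorem
    -- carries `p' = p Q'` to the whole disk.
    refine AnalyticOnNhd.eqOn_of_preconnected_of_frequently_eq
      (analyticOnNhd_unitDisk_iff.2 hpd).deriv
      ((analyticOnNhd_unitDisk_iff.2 hpd).mul (analyticOnNhd_unitDisk_iff.2 hQd).deriv)
      isPreconnected_unitDisk zero_mem_unitDisk (Eventually.frequently ?_)
    have hpne : ∀ᶠ z in 𝓝 (0 : ℂ), p z ≠ 0 :=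
      (hpdiff 0 zero_mem_unitDisk).continuousAt.eventually_ne (by simp [hp0])
    filter_upwards [self_mem_nhdsWithin, nhdsWithin_le_nhds hpne,
      nhdsWithin_le_nhds unitDisk_mem_nhds_zero] with z hz0 hpz hz
    have hz0 : z ≠ 0 := hz0
    have h1 := hfQ z hz
    have h2 : deriv f z = p z + z * deriv p z := by
      rw [funext hfp]
      have h3 : HasDerivAt (fun z => z * p z) (1 * p z + z * deriv p z) z :=
        (hasDerivAt_id z).mul (hpdiff z hz).hasDerivAt
      rw [h3.deriv, one_mul]
    simp only [starlikeQuotient, Function.update_of_ne hz0] at h1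
    rw [h2, hfp z] at h1
    change deriv p z = p z * deriv Q z
    rw [(hQ z hz).deriv]
    field_simp at h1
    have h3 : z * deriv p z = z * (p z * Q' z) := by linear_combination h1
    exact mul_left_cancel₀ hz0 h3
  have hder : ∀ z ∈ unitDisk, HasDerivAt (fun z => p z * Complex.exp (-Q z)) 0 z := by
    intro z hz
    have h1 := (hpdiff z hz).hasDerivAt.mul (hQ z hz).neg.cexp
    refine h1.congr_deriv ?_
    rw [hlog z hz, (hQ z hz).deriv]
    ring
  intro z hz
  have hconst := (convex_ball (0 : ℂ) 1).norm_image_sub_le_of_norm_hasDerivWithin_le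
      (C := 0) (fun x hx => (hder x hx).hasDerivWithinAt) (fun x hx => by simp)
      zero_mem_unitDisk hz
  simp only [zero_mul, norm_le_zero_iff, hp0, hQ0, neg_zero, Complex.exp_zero, mul_one,
    sub_eq_zero] at hconst
  rw [Complex.exp_neg] at hconst
  exact eq_of_mul_inv_eq_one hconst

/-! ### The bound on `α` and the conclusion -/

lemma exp_add_one_ne_zero {x : ℂ} (hx : ‖x‖ ≤ 1) : Complex.exp x + 1 ≠ 0 := by
  intro h
  have h1 := congrArg Complex.re h
  rw [Complex.add_re, Complex.exp_re, Complex.one_re, Complex.zero_re] at h1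
  have h2 := abs_le.1 ((Complex.abs_im_le_norm x).trans hx)
  have h3 : 0 < Real.cos x.im := Real.cos_pos_of_le_one (abs_le.2 h2)
  have := mul_pos (Real.exp_pos x.re) h3
  linarith

/-- Since `3 - 2√2 = (√2 - 1)²`, the hypothesis says `√α ≤ √2 - 1`, with equality in the second
claim at the endpoint. The factor `1/(1 - α)` is the bound for `|Q|`. -/
lemma lt_one_and_sqrt_mul_le {α : ℝ} (hα₁ : α ≤ 3 - 2 * √2) :
    α < 1 ∧ √α * (1 / (1 - α)) ≤ 1 / 2 := by
  have h2 : √2 ^ 2 = 2 := Real.sq_sqrt (by norm_num)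
  have h1 : 1 < √2 := Real.lt_sqrt_of_sq_lt (by norm_num)
  have h3 : √α ≤ √2 - 1 := Real.sqrt_le_iff.2 ⟨by linarith, by nlinarith⟩
  have h4 : α < 1 := by linarith
  refine ⟨h4, ?_⟩
  rw [mul_one_div, div_le_iff₀ (by linarith)]
  linarith

end BoothStarlike

open BoothStarlike in
theorem mainTheorem2 (α : ℝ) (hα₀ : 0 ≤ α) (hα₁ : α ≤ 3 - 2 * Real.sqrt 2)
    (f : ℂ → ℂ) (hf : f ∈ BoothStarlike.BS α) :
    BoothStarlike.Subordinate (BoothStarlike.divZ f) (BoothStarlike.extremalQuotient α) := by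
  obtain ⟨hfn, w, hw, hfw⟩ := hf
  obtain ⟨hαlt, hsα⟩ := lt_one_and_sqrt_mul_le hα₁
  obtain ⟨Q, Q', hQ, hQ0, hQH, hQC⟩ := exists_mul_deriv_eq
    (differentiableOn_boothMap_comp hα₀ hαlt hw) (by simp [hw.2.1, boothMap])
    (fun z hz => norm_boothMap_le hα₀ hαlt (hw.2.2 z hz).le)
  have hfQ := divZ_eq_exp hfn hQ hQ0 fun z hz => (hfw z hz).trans (hQH z hz).symm
  rcases hα₀.eq_or_lt with rfl | hαpos
  · refine ⟨Q, ⟨analyticOnNhd_unitDisk_iff.2 fun z hz =>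
      (hQ z hz).differentiableAt.differentiableWithinAt, hQ0, ?_⟩, fun z hz => ?_⟩
    · exact norm_lt_one_of_mul_deriv_eq le_rfl hαlt hQ hQ0 hw.2.2
        fun z hz => by simpa using hQH z hz
    · simpa [extremalQuotient] using hfQ z hz
  · set s : ℝ := √α with hs
    have hspos : 0 < s := Real.sqrt_pos.2 hαpos
    have hsc : (s : ℂ) ≠ 0 := by exact_mod_cast hspos.ne'
    have hss : (s : ℂ) ^ 2 = α := by exact_mod_cast Real.sq_sqrt hα₀
    have hbound : ∀ z ∈ unitDisk, ‖2 * (s : ℂ) * Q z‖ ≤ 1 := by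
      intro z hz
      rw [norm_mul, norm_mul, Complex.norm_real, Real.norm_of_nonneg hspos.le, Complex.norm_ofNat]
      have := mul_le_mul_of_nonneg_left (hQC z hz) hspos.le
      linarith
    let E : ℂ → ℂ := fun z => Complex.exp (2 * s * Q z)
    have hE1 : ∀ z ∈ unitDisk, E z + 1 ≠ 0 := fun z hz => exp_add_one_ne_zero (hbound z hz)
    have hE : ∀ z ∈ unitDisk, HasDerivAt E (E z * (2 * s * Q' z)) z := fun z hz =>
      ((hQ z hz).const_mul _).cexp
    -- This is `tanh(s Q)/s`, the solution of `(1 + s v)/(1 - s v) = exp(2 s Q)`.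
    let v : ℂ → ℂ := fun z => (E z - 1) / (s * (E z + 1))
    have hE0 : E 0 = 1 := by simp [E, hQ0]
    have hv0 : v 0 = 0 := by simp [v, hE0]
    have hv : ∀ z ∈ unitDisk, HasDerivAt v ((1 - α * v z ^ 2) * Q' z) z := by
      intro z hz
      have h1 := hE1 z hz
      have h2 := ((hE z hz).sub_const 1).div (((hE z hz).add_const 1).const_mul (s : ℂ))
        (mul_ne_zero hsc h1)
      refine h2.congr_deriv ?_
      simp only [v]
      rw [← hss]
      field_simp
      ring
    refine ⟨v, ⟨analyticOnNhd_unitDisk_iff.2 fun z hz =>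
      (hv z hz).differentiableAt.differentiableWithinAt, hv0, ?_⟩, fun z hz => ?_⟩
    · refine norm_lt_one_of_mul_deriv_eq hα₀ hαlt hv hv0 hw.2.2 fun z hz => ?_
      rw [← hQH z hz]
      ring
    · have h1 := hE1 z hz
      have hbase : (1 + (s : ℂ) * v z) / (1 - s * v z) = E z := by
        have h3 : 1 - s * v z = 2 / (E z + 1) := by
          simp only [v]
          field_simp
          ring
        have h4 : 1 + s * v z = 2 * E z / (E z + 1) := by
          simp only [v]
          field_simp
          ring
        rw [h3, h4]
        field_simp
      have him := abs_le.1 ((Complex.abs_im_le_norm _).trans (hbound z hz))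
      have hlog : Complex.log (E z) = 2 * s * Q z :=
        Complex.log_exp (by linarith [Real.pi_gt_three]) (by linarith [Real.pi_gt_three])
      rw [hfQ z hz, extremalQuotient, if_neg hαpos.ne', ← hs, hbase,
        Complex.cpow_def_of_ne_zero (Complex.exp_ne_zero _), hlog]
      congr 1
      push_cast
      field_simp
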